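/- For $\theta\in(0,\frac{\pi}{2})$ let $\lambda=\cot\frac{\theta}{2}$ and let $\Sigma_\theta$ be the compact genus-one Riemann surface of the curve $w^2=(z^2+\lambda^2)(z^2+\lambda^{-2})$, including its two points over $z=\infty$. Put $K(m)=\int_0^{\pi/2}\frac{du}{\sqrt{1-m\sin^2u}}$ for $0<m<1$. For $\alpha,\beta\in\mathbb{R}$ let $$\sigma=\cos\tfrac{\alpha+\beta}{2}+i\cos\tfrac{\alpha-\beta}{2},\quad \delta=\sin\tfrac{\alpha-\beta}{2}+i\sin\tfrac{\alpha+\beta}{2},\quad g_{\theta,\alpha,\beta}(z,w)=\frac{\sigma z+\delta}{i(\overline{\sigma}-\overline{\delta}z)},\quad dh_\theta=\frac{\pi}{\sin\theta\,K(\sin^2\theta)}\,\frac{dz}{w}.$$ Let $$\mathcal{I}_1=\{(\theta,\alpha,\beta)\in(0,\tfrac{\pi}{2})\times[0,\tfrac{\pi}{2}]^2 : (\alpha,\beta)\ne(0,\theta)\},$$ $$\mathcal{I}_2=\{(\theta,\alpha,\beta)\in(0,\tfrac{\pi}{2})\times[-\tfrac{\pi}{2},\tfrac{\pi}{2}]\times[-\pi,\pi]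 : (\alpha,\beta)\ne(0,\pm\theta),(0,\pm(\pi-\theta))\}.$$ For $(\theta,\alpha,\beta)\in\mathcal{I}_2$, the standard example $M_{\theta,\alpha,\beta}$ is the doubly periodic minimal surface in $\mathbb{R}^3$ with Weierstrass data $(g,dh)=(g_{\theta,\alpha,\beta},dh_\theta)$ on $\Sigma_\theta\setminus g^{-1}(\{0,\infty\})$: it is the set of all values of $\mathrm{Re}\int_{p_0}^{p}\Phi$, where $\Phi=\left(\frac12(\frac1g-g),\frac i2(\frac1g+g),1\right)dh$, along piecewise $C^1$ paths in $\Sigma_\theta\setminus g^{-1}(\{0,\infty\})$ starting at a base point $p_0$. Its period vectors are the vectors $\mathrm{Re}\int_\gamma\Phi$ along closed piecewise $C^1$ curves $\gamma$ in $\Sigma_\theta\setminus g^{-1}(\{0,\infty\})$. The conjugate surface $M^*_{\theta,\alpha,\beta}$ and its period vectors are defined in the same way from the Weierstrass data $(g,i\,dh)$. **Lemma.** Let $(\theta,\alpha,\beta)\in\mathcal{I}_1$. Then $(\frac{\pi}{2}-\theta,\alpha,\beta+\frac{\pi}{2})\in\mathcal{I}_2$, and $M_{\frac{\pi}{2}-\theta,\alpha,\beta+\frac{\pi}{2}}$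 coincides with $M^*_{\theta,\alpha,\beta}$ up to a homothety and a translation. Precisely, with $r=\frac{K(\sin^2\theta)}{K(\cos^2\theta)}>0$, for every choice of the base points of the two surfaces there is $v\in\mathbb{R}^3$ such that $$M_{\frac{\pi}{2}-\theta,\alpha,\beta+\frac{\pi}{2}}=r\,M^*_{\theta,\alpha,\beta}+v ,$$ and the set of period vectors of $M_{\frac{\pi}{2}-\theta,\alpha,\beta+\frac{\pi}{2}}$ is $r$ times the set of period vectors of $M^*_{\theta,\alpha,\beta}$. -/

import Mathlib

noncomputable section

/-! ### Parameters and elliptic integral -/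

/-- The parameter set `𝓘₁` of triples `(θ, α, β)`. -/
def paramSetOne : Set (ℝ × ℝ × ℝ) :=
  {p | p.1 ∈ Set.Ioo 0 (Real.pi / 2) ∧ p.2.1 ∈ Set.Icc 0 (Real.pi / 2) ∧
    p.2.2 ∈ Set.Icc 0 (Real.pi / 2) ∧ (p.2.1, p.2.2) ≠ (0, p.1)}

/-- The extended parameter set `𝓘₂` of triples `(θ, α, β)`. -/
def paramSetTwo : Set (ℝ × ℝ × ℝ) :=
  {p | p.1 ∈ Set.Ioo 0 (Real.pi / 2) ∧
    p.2.1 ∈ Set.Icc (-(Real.pi / 2)) (Real.pi / 2) ∧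
    p.2.2 ∈ Set.Icc (-Real.pi) Real.pi ∧
    (p.2.1, p.2.2) ≠ (0, p.1) ∧ (p.2.1, p.2.2) ≠ (0, -p.1) ∧
    (p.2.1, p.2.2) ≠ (0, Real.pi - p.1) ∧ (p.2.1, p.2.2) ≠ (0, -(Real.pi - p.1))}

/-- Complete elliptic integral of the first kind `K(m)`, for `0 < m < 1`. -/
def ellipticK (m : ℝ) : ℝ :=
  ∫ u in (0 : ℝ)..(Real.pi / 2), 1 / Real.sqrt (1 - m * Real.sin u ^ 2)

/-! ### The torus `Σ_θ`

The compact curve `w² = (z² + lam²)(z² + lam⁻²)`, with its two points over `z = ∞`, is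
described by weighted homogeneous coordinates `[x : z : w]`, of weights `1, 1, 2`. The point
`[x : z : w]` with `x ≠ 0` is the affine point `(z / x, w / x²)`, and the points at infinity
`(∞, ±∞)` are `[0 : 1 : ±1]`. -/

/-- Homogeneous coordinates `(x, z, w)`. -/
abbrev HCoord : Type := ℂ × ℂ × ℂ

/-- `lam(θ) = cot (θ / 2)`. -/
def lam (θ : ℝ) : ℂ := ((Real.cot (θ / 2) : ℝ) : ℂ)

/-- The quartic form `(z² + lam² x²)(z² + lam⁻² x²)`. -/
def quartic (θ : ℝ) (x z : ℂ) : ℂ :=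
  (z ^ 2 + lam θ ^ 2 * x ^ 2) * (z ^ 2 + (lam θ)⁻¹ ^ 2 * x ^ 2)

/-- The partial derivative of `quartic θ x z` with respect to `z`. -/
def quarticDz (θ : ℝ) (x z : ℂ) : ℂ :=
  2 * z * (z ^ 2 + (lam θ)⁻¹ ^ 2 * x ^ 2) + (z ^ 2 + lam θ ^ 2 * x ^ 2) * (2 * z)

/-- The homogeneous coordinates of the points of `Σ_θ`. -/
def torusCone (θ : ℝ) : Set HCoord :=
  {p | (p.1, p.2.1) ≠ (0, 0) ∧ p.2.2 ^ 2 = quartic θ p.1 p.2.1}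

/-- `p` and `q` are homogeneous coordinates of the same point of `Σ_θ`. -/
def SamePoint (p q : HCoord) : Prop :=
  ∃ t : ℂ, t ≠ 0 ∧ q = (t * p.1, t * p.2.1, t ^ 2 * p.2.2)

/-- The holomorphic differential `dz / w` of `Σ_θ`, at the point `p = (x, z, w)`, applied to a
vector `v = (dx, dz, dw)` tangent to `torusCone θ`. Since `d(z/x) / (w/x²) = (x dz - z dx) / w`,
this is the first formula away from the branch points. At a branch point (`w = 0`, hence
`x ≠ 0`), where `2 w dw = d(quartic)`, it is `2 dw / (∂ quartic / ∂z)` in affine coordinates. -/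
def holoDiff (θ : ℝ) (p v : HCoord) : ℂ :=
  open Classical in
  if p.2.2 = 0 then 2 * p.1 * v.2.2 / quarticDz θ p.1 p.2.1
  else (p.1 * v.2.1 - p.2.1 * v.1) / p.2.2

/-! ### Weierstrass data of the standard examples -/

/-- `μ(θ) = π csc θ / K(sin² θ)`. -/
def mu (θ : ℝ) : ℝ := Real.pi / (Real.sin θ * ellipticK (Real.sin θ ^ 2))

/-- The height differential `dh = μ(θ) dz / w` of `M_{θ,α,β}`. -/
def heightDiff (θ : ℝ) (p v : HCoord) : ℂ := (mu θ : ℂ) * holoDiff θ p v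

/-- `σ = cos ((α + β) / 2) + i cos ((α - β) / 2)`. -/
def sig (α β : ℝ) : ℂ :=
  (Real.cos ((α + β) / 2) : ℂ) + Complex.I * (Real.cos ((α - β) / 2) : ℂ)

/-- `δ = sin ((α - β) / 2) + i sin ((α + β) / 2)`. -/
def del (α β : ℝ) : ℂ :=
  (Real.sin ((α - β) / 2) : ℂ) + Complex.I * (Real.sin ((α + β) / 2) : ℂ)

/-- Numerator of the Gauss map, `σ z + δ`, homogenized. -/
def gaussNum (α β : ℝ) (p : HCoord) : ℂ := sig α β * p.2.1 + del α β * p.1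

/-- Denominator of the Gauss map, `i (σ̄ - δ̄ z)`, homogenized. -/
def gaussDen (α β : ℝ) (p : HCoord) : ℂ :=
  Complex.I * (starRingEnd ℂ (sig α β) * p.1 - starRingEnd ℂ (del α β) * p.2.1)

/-- The Gauss map `g = (σ z + δ) / (i (σ̄ - δ̄ z))` of `M_{θ,α,β}`, away from its poles. -/
def gaussMap (α β : ℝ) (p : HCoord) : ℂ := gaussNum α β p / gaussDen α β p

/-- The homogeneous coordinates of the points of `Σ_θ` other than the ends
`g⁻¹ {0, ∞}` of `M_{θ,α,β}`. -/
def puncturedCone (θ α β : ℝ) : Set HCoord :=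
  {p | p ∈ torusCone θ ∧ gaussNum α β p ≠ 0 ∧ gaussDen α β p ≠ 0}

/-! ### Weierstrass representation -/

/-- The Weierstrass form `Φ = (½ (1/g - g), (i/2) (1/g + g), 1) dh` of the data `(g, dh)`. -/
def weierstrassForm (g : HCoord → ℂ) (dh : HCoord → HCoord → ℂ) (p v : HCoord) : Fin 3 → ℂ :=
  ![1 / 2 * (1 / g p - g p) * dh p v, Complex.I / 2 * (1 / g p + g p) * dh p v, dh p v]

/-- `IsPathIntegral U Ω p q J`: there is a piecewise `C¹` path in `U` from `p` to `q` (a finite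
succession of `C¹` arcs parametrized by `[0, 1]`) along which the integral of `Ω` is `J`. -/
inductive IsPathIntegral (U : Set HCoord) (Ω : HCoord → HCoord → Fin 3 → ℂ) (p : HCoord) :
    HCoord → (Fin 3 → ℂ) → Prop
  | refl : p ∈ U → IsPathIntegral U Ω p p 0
  | arc (J : Fin 3 → ℂ) (γ γ' : ℝ → HCoord)
      (mem : ∀ t ∈ Set.Icc (0 : ℝ) 1, γ t ∈ U)
      (deriv : ∀ t ∈ Set.Icc (0 : ℝ) 1, HasDerivWithinAt γ (γ' t) (Set.Icc 0 1) t)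
      (cont : ContinuousOn γ' (Set.Icc 0 1))
      (start : IsPathIntegral U Ω p (γ 0) J) :
      IsPathIntegral U Ω p (γ 1) (fun k => J k + ∫ t in (0 : ℝ)..1, Ω (γ t) (γ' t) k)

/-- The vector of `ℝ³` whose coordinates are the real parts of those of `J`. -/
def reVec (J : Fin 3 → ℂ) : EuclideanSpace ℝ (Fin 3) := WithLp.toLp 2 fun k => (J k).re

/-- The surface of `ℝ³` with Weierstrass data `(g, dh)` on `U` and base point `p₀`: the set of
all values of the (multivalued) immersion `q ↦ Re ∫_{p₀}^q Φ`. -/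
def weierstrassSurface (U : Set HCoord) (g : HCoord → ℂ) (dh : HCoord → HCoord → ℂ)
    (p₀ : HCoord) : Set (EuclideanSpace ℝ (Fin 3)) :=
  {y | ∃ q J, IsPathIntegral U (weierstrassForm g dh) p₀ q J ∧ y = reVec J}

/-- The period vectors `Re ∫_γ Φ` along all closed curves `γ` of the parameter surface. -/
def weierstrassPeriods (U : Set HCoord) (g : HCoord → ℂ) (dh : HCoord → HCoord → ℂ) :
    Set (EuclideanSpace ℝ (Fin 3)) :=
  {y | ∃ p q J, SamePoint p q ∧ IsPathIntegral U (weierstrassForm g dh) p q J ∧ y = reVec J}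

/-- The standard example `M_{θ,α,β}`, as a doubly periodic surface of `ℝ³`, with the point
`p₀` of the punctured torus placed at the origin. -/
def standardExample (θ α β : ℝ) (p₀ : HCoord) : Set (EuclideanSpace ℝ (Fin 3)) :=
  weierstrassSurface (puncturedCone θ α β) (gaussMap α β) (heightDiff θ) p₀

/-- The periods of `M_{θ,α,β}`. -/
def standardPeriods (θ α β : ℝ) : Set (EuclideanSpace ℝ (Fin 3)) :=
  weierstrassPeriods (puncturedCone θ α β) (gaussMap α β) (heightDiff θ)

/-- The conjugate surface of `M_{θ,α,β}`, with Weierstrass data `(g, i dh)`. -/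
def conjugateExample (θ α β : ℝ) (p₀ : HCoord) : Set (EuclideanSpace ℝ (Fin 3)) :=
  weierstrassSurface (puncturedCone θ α β) (gaussMap α β)
    (fun p v => Complex.I * heightDiff θ p v) p₀

/-- The periods of the conjugate surface of `M_{θ,α,β}`. -/
def conjugatePeriods (θ α β : ℝ) : Set (EuclideanSpace ℝ (Fin 3)) :=
  weierstrassPeriods (puncturedCone θ α β) (gaussMap α β)
    (fun p v => Complex.I * heightDiff θ p v)

end

/-!
The map `(x, z, w) ↦ (x - i z, z - i x, c w)`, with `c = -2 i tan θ`, is linear on homogeneous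
coordinates and induces an isomorphism `F : Σ_θ → Σ_{π/2-θ}`. On the `z`-sphere it is a quarter turn
about `±1`, which moves the four branch points `±i cot (θ/2)`, `±i tan (θ/2)`, all on the
imaginary axis, to those of `Σ_{π/2-θ}` (`quartic_quarterTurn`). The coefficients `σ, δ` are such that
replacing `β` by `β + π/2` composes the Gauss map with the inverse quarter turn, so `g' ∘ F = g`
(`gaussMap_quarterTurn`), while `F` pulls `dz / w` back to `(2 / c) dz / w`
(`holoDiff_quarterTurn`). As `2 / c = i cot θ`, the constants `μ` give `F^* dh' = r i dh` with
`r = K(sin² θ) / K(cos² θ)`, hence `F^* Φ' = r Φ^*`, where `Φ^*` is the Weierstrass form of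
`(g, i dh)` (`weierstrassForm_quarterTurn`). Integrating along corresponding paths gives the
equality of the periods, and that of the surfaces when the base points correspond under `F`.

For arbitrary base points the punctured torus has to be connected
(`exists_path_of_branchPoint`). Along a segment of the `(x, z)`-plane that misses the zeros of
the four linear factors of the quartic, each factor has a smooth square root, and the product of
the roots lifts the segment to the curve. A generic complex multiple of the target point
keeps the segment away from branch points and ends, so every point is joined to one of the two
points over a fixed generic `z`. These two are joined to each other through the branch point
`z = i tan (θ/2)`, which is never an end for parameters in `𝓘₁`: near it, `s ↦ e + s² b` has a lift
on each sheet.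
-/

noncomputable section

/-! ### Path integrals -/

namespace IsPathIntegral

variable {U U' : Set HCoord} {Ω Ω' : HCoord → HCoord → Fin 3 → ℂ} {p q s : HCoord}
  {J J' : Fin 3 → ℂ}

lemma mem_right (h : IsPathIntegral U Ω p q J) : q ∈ U := by
  cases h with
  | refl h => exact h
  | arc J γ γ' mem deriv cont start => exact mem 1 (by simp)

lemma trans (h : IsPathIntegral U Ω p q J) (h' : IsPathIntegral U Ω q s J') :
    IsPathIntegral U Ω p s (J + J') := by
  induction h' with
  | refl => simpa using h
  | arc J' γ γ' mem deriv cont start ih =>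
    have := arc _ γ γ' mem deriv cont ih
    simpa only [Pi.add_apply, add_assoc] using! this

/-- The reversed path; the form has to be odd in the tangent vector. -/
lemma symm (hΩ : ∀ a v, Ω a (-v) = -Ω a v) (h : IsPathIntegral U Ω p q J) :
    IsPathIntegral U Ω q p (-J) := by
  induction h with
  | refl h => simpa using IsPathIntegral.refl (Ω := Ω) h
  | arc J γ γ' mem deriv cont start ih =>
    have maps : Set.MapsTo (fun t : ℝ => 1 - t) (Set.Icc 0 1) (Set.Icc 0 1) := by
      intro t ht
      simpa [and_comm] using ht
    have hback := arc (U := U) (Ω := Ω) (p := γ 1) 0 (fun t => γ (1 - t)) (fun t => -γ' (1 - t))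
      (fun t ht => mem _ (maps ht))
      (fun t ht => by
        have h1 : HasDerivWithinAt (fun t : ℝ => 1 - t) (-1) (Set.Icc 0 1) t := by
          simpa using ((hasDerivWithinAt_id t (Set.Icc (0 : ℝ) 1)).const_sub 1)
        have h2 := (deriv _ (maps ht)).scomp t h1 maps
        rw [neg_one_smul] at h2
        exact h2)
      (cont.comp (by fun_prop) maps).neg
      (by simpa using IsPathIntegral.refl (Ω := Ω) (mem 1 (by simp)))
    simp only [sub_self] at hback
    have hJ : (fun k => (0 : Fin 3 → ℂ) k + ∫ t in (0 : ℝ)..1, Ω (γ (1 - t)) (-γ' (1 - t)) k) =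
        fun k => -∫ t in (0 : ℝ)..1, Ω (γ t) (γ' t) k := by
      funext k
      simp only [hΩ, Pi.neg_apply, Pi.zero_apply, zero_add, intervalIntegral.integral_neg]
      rw [intervalIntegral.integral_comp_sub_left (fun t => Ω (γ t) (γ' t) k) 1]
      simp
    rw [hJ] at hback
    convert hback.trans ih using 1
    funext k
    simp [add_comm]

/-- Path integrals are transported by a linear map that multiplies the form by a constant. -/
lemma map (F : HCoord →L[ℝ] HCoord) (c : ℂ) (hF : Set.MapsTo F U U')
    (hΩ : ∀ a ∈ U, ∀ v, Ω' (F a) (F v) = c • Ω a v) (h : IsPathIntegral U Ω p q J) :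
    IsPathIntegral U' Ω' (F p) (F q) (c • J) := by
  induction h with
  | refl h => simpa using IsPathIntegral.refl (Ω := Ω') (hF h)
  | arc J γ γ' mem deriv cont start ih =>
    have := arc (U := U') _ (fun t => F (γ t)) (fun t => F (γ' t)) (fun t ht => hF (mem t ht))
      (fun t ht => F.hasFDerivAt.comp_hasDerivWithinAt t (deriv t ht))
      (F.continuous.comp_continuousOn cont) ih
    convert this using 1
    funext k
    simp only [Pi.smul_apply, smul_eq_mul, mul_add]
    congr 1
    rw [← intervalIntegral.integral_const_mul]
    refine intervalIntegral.integral_congr fun t ht => ?_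
    rw [Set.uIcc_of_le zero_le_one] at ht
    simp [hΩ _ (mem t ht)]

/-- Existence of a path is transported by a linear map, whatever forms are integrated. -/
lemma exists_map (F : HCoord →L[ℝ] HCoord) (hF : Set.MapsTo F U U')
    (h : IsPathIntegral U Ω p q J) : ∃ J', IsPathIntegral U' Ω' (F p) (F q) J' := by
  induction h with
  | refl h => exact ⟨0, .refl (hF h)⟩
  | arc J γ γ' mem deriv cont start ih =>
    obtain ⟨J', ih⟩ := ih
    exact ⟨_, arc (U := U') _ (fun t => F (γ t)) (fun t => F (γ' t)) (fun t ht => hF (mem t ht))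
      (fun t ht => F.hasFDerivAt.comp_hasDerivWithinAt t (deriv t ht))
      (F.continuous.comp_continuousOn cont) ih⟩

lemma exists_of_contDiffOn (γ : ℝ → HCoord) (hγ : ContDiffOn ℝ 1 γ (Set.Icc 0 1))
    (mem : ∀ t ∈ Set.Icc (0 : ℝ) 1, γ t ∈ U) : ∃ J, IsPathIntegral U Ω (γ 0) (γ 1) J :=
  ⟨_, arc 0 γ (derivWithin γ (Set.Icc 0 1)) mem
    (fun t ht => (hγ.differentiableOn one_ne_zero t ht).hasDerivWithinAt)
    (hγ.continuousOn_derivWithin (uniqueDiffOn_Icc zero_lt_one) le_rfl)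
    (.refl (mem 0 (by simp)))⟩

end IsPathIntegral

/-! ### Oddness of the forms in the tangent vector -/

lemma holoDiff_neg (θ : ℝ) (p v : HCoord) : holoDiff θ p (-v) = -holoDiff θ p v := by
  unfold holoDiff
  split_ifs <;> simp <;> ring

lemma weierstrassForm_neg {g : HCoord → ℂ} {dh : HCoord → HCoord → ℂ}
    (h : ∀ p v, dh p (-v) = -dh p v) (p v : HCoord) :
    weierstrassForm g dh p (-v) = -weierstrassForm g dh p v := by
  funext k
  fin_cases k <;> simp [weierstrassForm, h]

/-! ### Square roots and zeros along segments -/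

/-- Along the segment from `a` to `b`, run through with parameter `s²`, there is a `C¹` square root.
If `a = 0` it is `s √b`, which is why the parameter is `s²`; otherwise the ratio to `a` stays in the
slit plane, which is star-shaped about `1`. -/
lemma exists_sqrt_segment {a b : ℂ} (h : a ≠ 0 → b / a ∈ Complex.slitPlane) :
    ∃ r : ℝ → ℂ, ContDiffOn ℝ 1 r (Set.Icc 0 1) ∧
      ∀ s ∈ Set.Icc (0 : ℝ) 1, r s ^ 2 = a + (s : ℂ) ^ 2 * (b - a) := by
  have hofReal : ContDiff ℝ 1 (fun s : ℝ => (s : ℂ)) := Complex.ofRealCLM.contDiff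
  by_cases ha : a = 0
  · obtain ⟨c, hc⟩ := IsAlgClosed.exists_pow_nat_eq b two_pos
    refine ⟨fun s => s * c, (hofReal.mul contDiff_const).contDiffOn, fun s _ => ?_⟩
    rw [ha, ← hc]; ring
  · obtain ⟨c, hc⟩ := IsAlgClosed.exists_pow_nat_eq a two_pos
    have hmem : ∀ s ∈ Set.Icc (0 : ℝ) 1,
        1 + (s : ℂ) ^ 2 * (b / a - 1) ∈ Complex.slitPlane := by
      intro s hs
      have := Complex.starConvex_one_slitPlane (h ha) (a := 1 - s ^ 2) (b := s ^ 2)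
        (by nlinarith [hs.1, hs.2]) (sq_nonneg s) (by ring)
      convert this using 1
      simp [Complex.real_smul]
      ring
    refine ⟨fun s => c * Complex.exp (Complex.log (1 + (s : ℂ) ^ 2 * (b / a - 1)) / 2), ?_, ?_⟩
    · refine contDiffOn_const.mul (ContDiffOn.cexp (ContDiffOn.div_const ?_ _))
      intro s hs
      have h1 : ContDiffAt ℝ 1 Complex.log (1 + (s : ℂ) ^ 2 * (b / a - 1)) :=
        (Complex.contDiffAt_log (hmem s hs)).restrict_scalars ℝ
      exact (h1.comp s (contDiff_const.add ((hofReal.pow 2).mul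
        contDiff_const)).contDiffAt).contDiffWithinAt
    · intro s hs
      have : Complex.exp (Complex.log (1 + (s : ℂ) ^ 2 * (b / a - 1)) / 2) ^ 2 =
          1 + (s : ℂ) ^ 2 * (b / a - 1) := by
        rw [← Complex.exp_nat_mul]
        push_cast
        rw [mul_div_cancel₀ _ two_ne_zero, Complex.exp_log (Complex.slitPlane_ne_zero (hmem s hs))]
      rw [mul_pow, this, hc]
      field_simp

lemma segment_ne_zero {a b : ℂ} (ha : a ≠ 0) (h : b / a ∈ Complex.slitPlane) {s : ℝ}
    (hs : s ∈ Set.Icc (0 : ℝ) 1) : a + (s : ℂ) ^ 2 * (b - a) ≠ 0 := by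
  have := Complex.starConvex_one_slitPlane h (a := 1 - s ^ 2) (b := s ^ 2)
    (by nlinarith [hs.1, hs.2]) (sq_nonneg s) (by ring)
  have h0 := mul_ne_zero ha (Complex.slitPlane_ne_zero this)
  convert h0 using 1
  simp [Complex.real_smul]
  field_simp
  ring

lemma eventually_rotate_mem_slitPlane {a : ℂ} (ha : a ≠ 0) :
    ∀ᶠ k : ℝ in Filter.cofinite, (1 + Complex.I * k) * a ∈ Complex.slitPlane := by
  refine (Set.finite_singleton (-a.im / a.re)).subset fun k hk => ?_
  simp only [Set.mem_compl_iff, Set.mem_ofPred_eq, Complex.mem_slitPlane_iff, not_or, not_lt,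
    not_not] at hk
  obtain ⟨h1, h2⟩ := hk
  simp at h1 h2
  have hre : a.re ≠ 0 := by
    intro h0
    exact ha (Complex.ext h0 (by simpa [h0] using h2))
  rw [Set.mem_singleton_iff, eq_div_iff hre]
  linarith

lemma eventually_affine_ne_zero {a b : ℂ} (h : a ≠ 0 ∨ b ≠ 0) :
    ∀ᶠ z : ℂ in Filter.cofinite, b * z + a ≠ 0 := by
  refine (Set.finite_singleton (-a / b)).subset fun z hz => ?_
  simp only [Set.mem_compl_iff, Set.mem_ofPred_eq, not_not] at hz
  have hb : b ≠ 0 := by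
    rintro rfl
    simp at hz h
    exact h hz
  rw [Set.mem_singleton_iff, eq_div_iff hb]
  linear_combination hz

/-! ### Connectedness of the punctured torus -/

/-- The linear forms in `(x, z)`, given as `(coefficient of x, coefficient of z)`: the first four
are the factors of `quartic θ`, whose zeros are the branch points of `Σ_θ`; the last two are
`gaussNum α β` and `gaussDen α β`, whose zeros are the ends. -/
def specialForm (θ α β : ℝ) : Fin 6 → ℂ × ℂ :=
  ![(Complex.I * lam θ, 1), (-(Complex.I * lam θ), 1), (Complex.I * (lam θ)⁻¹, 1),
    (-(Complex.I * (lam θ)⁻¹), 1), (del α β, sig α β),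
    (Complex.I * starRingEnd ℂ (sig α β), -(Complex.I * starRingEnd ℂ (del α β)))]

/-- The value at `(x, z)` of the form `specialForm θ α β j`. -/
def specialVal (θ α β : ℝ) (j : Fin 6) (x z : ℂ) : ℂ :=
  (specialForm θ α β j).2 * z + (specialForm θ α β j).1 * x

section

variable {θ α β : ℝ}

lemma quartic_eq_specialVal (x z : ℂ) : quartic θ x z =
    specialVal θ α β 0 x z * specialVal θ α β 1 x z *
      (specialVal θ α β 2 x z * specialVal θ α β 3 x z) := by
  simp only [quartic, specialVal, specialForm, Matrix.cons_val]
  linear_combination ((lam θ ^ 2 + (lam θ)⁻¹ ^ 2) * x ^ 2 * z ^ 2 +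
    (1 - Complex.I ^ 2) * (lam θ ^ 2 * (lam θ)⁻¹ ^ 2 * x ^ 4)) * Complex.I_sq

lemma gaussNum_eq_specialVal (p : HCoord) : gaussNum α β p = specialVal θ α β 4 p.1 p.2.1 := rfl

lemma gaussDen_eq_specialVal (p : HCoord) : gaussDen α β p = specialVal θ α β 5 p.1 p.2.1 := by
  simp only [gaussDen, specialVal, specialForm, Matrix.cons_val]
  ring

lemma sig_ne_zero_or_del_ne_zero (α β : ℝ) : del α β ≠ 0 ∨ sig α β ≠ 0 := by
  by_contra! h
  have h1 := congrArg Complex.im h.1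
  have h2 := congrArg Complex.re h.2
  simp [del, sig, -Complex.ofReal_cos, -Complex.ofReal_sin] at h1 h2
  have := Real.sin_sq_add_cos_sq ((α + β) / 2)
  simp [h1, h2] at this

lemma specialForm_ne_zero (j : Fin 6) :
    (specialForm θ α β j).1 ≠ 0 ∨ (specialForm θ α β j).2 ≠ 0 := by
  have := sig_ne_zero_or_del_ne_zero α β
  fin_cases j <;> simp [specialForm] <;> tauto

lemma mem_puncturedCone_iff {p : HCoord} : p ∈ puncturedCone θ α β ↔
    p.2.2 ^ 2 = quartic θ p.1 p.2.1 ∧ gaussNum α β p ≠ 0 ∧ gaussDen α β p ≠ 0 := by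
  refine ⟨fun h => ⟨h.1.2, h.2⟩, fun h => ⟨⟨fun h0 => h.2.1 ?_, h.1⟩, h.2⟩⟩
  rw [Prod.mk.injEq] at h0
  simp [gaussNum, h0]

lemma mem_puncturedCone_iff_specialVal {p : HCoord} : p ∈ puncturedCone θ α β ↔
    p.2.2 ^ 2 = quartic θ p.1 p.2.1 ∧ specialVal θ α β 4 p.1 p.2.1 ≠ 0 ∧
      specialVal θ α β 5 p.1 p.2.1 ≠ 0 := by
  rw [← gaussNum_eq_specialVal, ← gaussDen_eq_specialVal, mem_puncturedCone_iff]

lemma specialVal_segment (j : Fin 6) (x z x' z' c : ℂ) :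
    specialVal θ α β j (x + c * (x' - x)) (z + c * (z' - z)) =
      specialVal θ α β j x z + c * (specialVal θ α β j x' z' - specialVal θ α β j x z) := by
  unfold specialVal; ring

/-- A segment of the `(x, z)`-plane that meets no special line, except perhaps at its start, lifts
to the punctured torus: `w` is a product of square roots of the four linear factors, each of
which has a `C¹` square root along the segment once it is run through with parameter `s²`. -/
lemma exists_path_segment {Ω : HCoord → HCoord → Fin 3 → ℂ} {p : HCoord}
    (hp : p ∈ puncturedCone θ α β) {x z : ℂ}
    (h : ∀ j, specialVal θ α β j p.1 p.2.1 ≠ 0 →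
      specialVal θ α β j x z / specialVal θ α β j p.1 p.2.1 ∈ Complex.slitPlane) :
    ∃ w J, IsPathIntegral (puncturedCone θ α β) Ω p (x, z, w) J := by
  obtain ⟨hw, h4, h5⟩ := mem_puncturedCone_iff_specialVal.1 hp
  choose r hr hsq using fun j => exists_sqrt_segment (h j)
  obtain ⟨ε, hε, hstart⟩ : ∃ ε : ℂ, ε ^ 2 = 1 ∧ ε * (r 0 0 * r 1 0 * (r 2 0 * r 3 0)) = p.2.2 := by
    have h0 : (r 0 0 * r 1 0 * (r 2 0 * r 3 0)) ^ 2 = p.2.2 ^ 2 := by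
      rw [hw, quartic_eq_specialVal (α := α) (β := β)]
      simp only [mul_pow, hsq _ 0 (by simp)]
      simp
    rcases sq_eq_sq_iff_eq_or_eq_neg.1 h0 with h0 | h0
    · exact ⟨1, by simp, by simpa using h0⟩
    · exact ⟨-1, by simp, by simp [h0]⟩
  let γ : ℝ → HCoord := fun s => (p.1 + (s : ℂ) ^ 2 * (x - p.1),
    p.2.1 + (s : ℂ) ^ 2 * (z - p.2.1), ε * (r 0 s * r 1 s * (r 2 s * r 3 s)))
  have hofReal : ContDiff ℝ 1 (fun s : ℝ => (s : ℂ)) := Complex.ofRealCLM.contDiff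
  have hγ : ContDiffOn ℝ 1 γ (Set.Icc 0 1) := by
    refine ContDiffOn.prodMk ?_ (ContDiffOn.prodMk ?_ ?_)
    · exact (contDiff_const.add ((hofReal.pow 2).mul contDiff_const)).contDiffOn
    · exact (contDiff_const.add ((hofReal.pow 2).mul contDiff_const)).contDiffOn
    · exact contDiffOn_const.mul (((hr 0).mul (hr 1)).mul ((hr 2).mul (hr 3)))
  obtain ⟨J, hJ⟩ := IsPathIntegral.exists_of_contDiffOn (U := puncturedCone θ α β) (Ω := Ω) γ hγ <| by
    intro s hs
    refine mem_puncturedCone_iff_specialVal.2 ⟨?_, ?_, ?_⟩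
    · simp only [γ, quartic_eq_specialVal (α := α) (β := β), specialVal_segment, mul_pow, hε,
        hsq _ s hs, one_mul]
    · simp only [γ, specialVal_segment]
      exact segment_ne_zero h4 (h 4 h4) hs
    · simp only [γ, specialVal_segment]
      exact segment_ne_zero h5 (h 5 h5) hs
  have h0 : γ 0 = p := by
    simp [γ, hstart]
  have h1 : γ 1 = (x, z, ε * (r 0 1 * r 1 1 * (r 2 1 * r 3 1))) := by simp [γ]
  rw [h0, h1] at hJ
  exact ⟨_, J, hJ⟩

lemma specialVal_mul (j : Fin 6) (c x z : ℂ) :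
    specialVal θ α β j (c * x) (c * z) = c * specialVal θ α β j x z := by
  unfold specialVal; ring

/-- Every point of the punctured torus is joined to some point over a given `(x, z)` off the special
lines. -/
lemma exists_path_over {Ω : HCoord → HCoord → Fin 3 → ℂ} {p : HCoord}
    (hp : p ∈ puncturedCone θ α β) {x z : ℂ} (h : ∀ j, specialVal θ α β j x z ≠ 0) :
    ∃ w J, IsPathIntegral (puncturedCone θ α β) Ω p (x, z, w) J := by
  -- Multiplying the target by a generic `1 + i k` makes the segment avoid the special lines.
  obtain ⟨k, hk⟩ : ∃ k : ℝ, ∀ j, specialVal θ α β j p.1 p.2.1 ≠ 0 →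
      (1 + Complex.I * k) * (specialVal θ α β j x z / specialVal θ α β j p.1 p.2.1) ∈
        Complex.slitPlane := by
    refine (Filter.eventually_all.2 fun j => ?_ : ∀ᶠ k : ℝ in Filter.cofinite, _).exists
    by_cases hj : specialVal θ α β j p.1 p.2.1 = 0
    · simp [hj]
    · filter_upwards [eventually_rotate_mem_slitPlane (div_ne_zero (h j) hj)] with k hk _ using hk
  set c : ℂ := 1 + Complex.I * k
  have hc : c⁻¹ ∈ Complex.slitPlane := by
    have hre : c.re = 1 := by simp [c]
    have hc0 : c ≠ 0 := fun h => by simp [h] at hre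
    refine Complex.mem_slitPlane_iff.2 (Or.inl ?_)
    rw [Complex.inv_re, hre]
    exact div_pos one_pos (Complex.normSq_pos.2 hc0)
  obtain ⟨w, J, hJ⟩ := exists_path_segment (Ω := Ω) hp (x := c * x) (z := c * z) fun j hj => by
    rw [specialVal_mul, mul_div_assoc]
    exact hk j hj
  have hend : (c * x, c * z, w) ∈ puncturedCone θ α β := hJ.mem_right
  obtain ⟨w', J', hJ'⟩ := exists_path_segment (Ω := Ω) hend (x := x) (z := z) fun j hj => by
    simp only [specialVal_mul]
    rw [div_mul_cancel_right₀ (h j)]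
    exact hc
  exact ⟨w', _, hJ.trans hJ'⟩

/-- The involution `(x, z, w) ↦ (x, z, -w)`, which exchanges the two sheets of `Σ_θ`. -/
def sheetSwap : HCoord →L[ℝ] HCoord :=
  (ContinuousLinearMap.fst ℝ ℂ (ℂ × ℂ)).prod
    (((ContinuousLinearMap.fst ℝ ℂ ℂ).comp (ContinuousLinearMap.snd ℝ ℂ (ℂ × ℂ))).prod
      (-(ContinuousLinearMap.snd ℝ ℂ ℂ).comp (ContinuousLinearMap.snd ℝ ℂ (ℂ × ℂ))))

lemma sheetSwap_apply (p : HCoord) : sheetSwap p = (p.1, p.2.1, -p.2.2) := rfl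

lemma mapsTo_sheetSwap :
    Set.MapsTo sheetSwap (puncturedCone θ α β) (puncturedCone θ α β) := by
  intro p hp
  rw [mem_puncturedCone_iff] at hp ⊢
  simpa [sheetSwap_apply, gaussNum, gaussDen] using hp

/-- A branch point that is not an end connects the two sheets, so the punctured torus is
connected as soon as it contains one. -/
lemma exists_path_of_branchPoint {Ω : HCoord → HCoord → Fin 3 → ℂ}
    (hΩ : ∀ a v, Ω a (-v) = -Ω a v) {b p q : HCoord} (hb : b ∈ puncturedCone θ α β)
    (hbw : b.2.2 = 0) (hp : p ∈ puncturedCone θ α β) (hq : q ∈ puncturedCone θ α β) :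
    ∃ J, IsPathIntegral (puncturedCone θ α β) Ω p q J := by
  obtain ⟨z, hz⟩ : ∃ z : ℂ, ∀ j, specialVal θ α β j 1 z ≠ 0 := by
    refine (Filter.eventually_all.2 fun j => ?_ : ∀ᶠ z : ℂ in Filter.cofinite, _).exists
    simpa [specialVal] using eventually_affine_ne_zero (specialForm_ne_zero j)
  obtain ⟨w, J, hJ⟩ := exists_path_over (Ω := Ω) hb hz
  obtain ⟨J', hJ'⟩ := hJ.exists_map (Ω' := Ω) sheetSwap mapsTo_sheetSwap
  have hfix : sheetSwap b = b := by
    rw [sheetSwap_apply, hbw, neg_zero, ← hbw]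
  rw [hfix, sheetSwap_apply] at hJ'
  have key : ∀ p ∈ puncturedCone θ α β, ∃ J, IsPathIntegral (puncturedCone θ α β) Ω p b J := by
    intro p hp
    obtain ⟨w₁, J₁, hJ₁⟩ := exists_path_over (Ω := Ω) hp hz
    have hw : w₁ = w ∨ w₁ = -w := by
      rw [← sq_eq_sq_iff_eq_or_eq_neg]
      exact hJ₁.mem_right.1.2.trans hJ.mem_right.1.2.symm
    rcases hw with rfl | rfl
    · exact ⟨_, hJ₁.trans (hJ.symm hΩ)⟩
    · exact ⟨_, hJ₁.trans (hJ'.symm hΩ)⟩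
  obtain ⟨J₁, h₁⟩ := key p hp
  obtain ⟨J₂, h₂⟩ := key q hq
  exact ⟨_, h₁.trans (h₂.symm hΩ)⟩

lemma inv_lam (θ : ℝ) : (lam θ)⁻¹ = ((Real.sin (θ / 2) / Real.cos (θ / 2) : ℝ) : ℂ) := by
  rw [lam, ← Complex.ofReal_inv, Real.cot_eq_cos_div_sin, inv_div]

/-- The branch point `z = i tan (θ / 2)` is not an end: with `A = (α + β) / 2` and
`B = (α - β) / 2`, the imaginary part of the numerator of `g` is `sin (A + θ/2) / cos (θ/2)`, and
the real part of the denominator is `cos (B - θ/2) / cos (θ/2)`. -/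
lemma branchPoint_mem_puncturedCone (h : (θ, α, β) ∈ paramSetOne) :
    ((1, Complex.I * (lam θ)⁻¹, 0) : HCoord) ∈ puncturedCone θ α β := by
  obtain ⟨⟨hθ0, hθ1⟩, ⟨hα0, hα1⟩, ⟨hβ0, hβ1⟩, -⟩ := h
  dsimp only at *
  have hpi := Real.pi_pos
  have hc : 0 < Real.cos (θ / 2) := Real.cos_pos_of_mem_Ioo ⟨by linarith, by linarith⟩
  refine ⟨⟨by simp, ?_⟩, fun h0 => ?_, fun h0 => ?_⟩
  · simp [quartic, mul_pow]
  · have h1 := congrArg Complex.im h0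
    simp [gaussNum, inv_lam, sig, del, -Complex.ofReal_cos, -Complex.ofReal_sin,
      -Complex.ofReal_div] at h1
    have h2 : 0 < Real.sin ((α + β) / 2 + θ / 2) :=
      Real.sin_pos_of_pos_of_lt_pi (by linarith) (by linarith)
    rw [Real.sin_add] at h2
    field_simp at h1
    linarith
  · have h1 := congrArg Complex.re h0
    simp [gaussDen, inv_lam, sig, del, -Complex.ofReal_cos, -Complex.ofReal_sin,
      -Complex.ofReal_div] at h1
    have h2 : 0 < Real.cos ((α - β) / 2 - θ / 2) :=
      Real.cos_pos_of_mem_Ioo ⟨by linarith, by linarith⟩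
    rw [Real.cos_sub] at h2
    field_simp at h1
    linarith

end

/-! ### The isomorphism of the two tori -/

/-- The factor by which the isomorphism `Σ_θ → Σ_{π/2-θ}` multiplies `w`. -/
def turnFactor (θ : ℝ) : ℂ := -(2 * Complex.I * (Real.tan θ : ℂ))

lemma turnFactor_ne_zero {θ : ℝ} (hθ : θ ∈ Set.Ioo 0 (Real.pi / 2)) : turnFactor θ ≠ 0 := by
  have h : (Real.tan θ : ℂ) ≠ 0 := by
    exact_mod_cast (Real.tan_pos_of_pos_of_lt_pi_div_two hθ.1 hθ.2).ne'
  exact neg_ne_zero.2 (mul_ne_zero (mul_ne_zero two_ne_zero Complex.I_ne_zero) h)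

/-- The linear map `(x, z, w) ↦ (x - i z, z - i x, c w)` with `c = turnFactor θ`. It induces the
isomorphism `Σ_θ → Σ_{π/2-θ}` that covers a quarter turn of the `z`-sphere about `±1`. -/
def quarterTurn (θ : ℝ) (p : HCoord) : HCoord :=
  (p.1 - Complex.I * p.2.1, p.2.1 - Complex.I * p.1,
    turnFactor θ * p.2.2)

/-- The inverse of `quarterTurn θ`. -/
def quarterTurnInv (θ : ℝ) (p : HCoord) : HCoord :=
  ((p.1 + Complex.I * p.2.1) / 2, (p.2.1 + Complex.I * p.1) / 2,
    (turnFactor θ)⁻¹ * p.2.2)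

/-- `quarterTurn θ` as a continuous linear equivalence. -/
def quarterTurnEquiv (θ : ℝ) (hθ : θ ∈ Set.Ioo 0 (Real.pi / 2)) : HCoord ≃L[ℝ] HCoord :=
  LinearEquiv.toContinuousLinearEquiv
  { toFun := quarterTurn θ
    invFun := quarterTurnInv θ
    map_add' := fun p q => by
      simp only [quarterTurn, Prod.fst_add, Prod.snd_add, Prod.mk_add_mk]
      congr 1 <;> [ring; (congr 1 <;> ring)]
    map_smul' := fun c p => by
      simp only [quarterTurn, Prod.smul_fst, Prod.smul_snd, Complex.real_smul, Prod.smul_mk,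
        RingHom.id_apply]
      congr 1 <;> [ring; (congr 1 <;> ring)]
    left_inv := fun p => by
      simp only [quarterTurn, quarterTurnInv]
      refine Prod.ext ?_ (Prod.ext ?_ ?_)
      · linear_combination (-p.1 / 2) * Complex.I_sq
      · linear_combination (-p.2.1 / 2) * Complex.I_sq
      · exact inv_mul_cancel_left₀ (turnFactor_ne_zero hθ) _
    right_inv := fun p => by
      simp only [quarterTurn, quarterTurnInv]
      refine Prod.ext ?_ (Prod.ext ?_ ?_)
      · linear_combination (-p.1 / 2) * Complex.I_sq
      · linear_combination (-p.2.1 / 2) * Complex.I_sq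
      · exact mul_inv_cancel_left₀ (turnFactor_ne_zero hθ) _ }

section

variable {θ α β : ℝ}

/-- With `l = cot (θ/2) > 1`, the parameter of the other torus is `(l + 1) / (l - 1)`. -/
lemma lam_relations (hθ : θ ∈ Set.Ioo 0 (Real.pi / 2)) :
    lam θ ≠ 0 ∧ lam θ - 1 ≠ 0 ∧ lam θ + 1 ≠ 0 ∧
    lam (Real.pi / 2 - θ) = (lam θ + 1) / (lam θ - 1) ∧
    (Real.tan θ : ℂ) = 2 * lam θ / ((lam θ - 1) * (lam θ + 1)) := by
  obtain ⟨h0, h1⟩ := hθ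
  have hs : 0 < Real.sin (θ / 2) := Real.sin_pos_of_pos_of_lt_pi (by linarith) (by linarith)
  have hcs : Real.sin (θ / 2) < Real.cos (θ / 2) := by
    rw [← Real.cos_pi_div_two_sub]
    exact Real.cos_lt_cos_of_nonneg_of_le_pi (by linarith) (by linarith) (by linarith)
  set s := Real.sin (θ / 2)
  set c := Real.cos (θ / 2)
  have hl : Real.cot (θ / 2) = c / s := Real.cot_eq_cos_div_sin _
  have hne : c - s ≠ 0 := by linarith
  have hl' : Real.cot ((Real.pi / 2 - θ) / 2) = (c + s) / (c - s) := by
    have e : (Real.pi / 2 - θ) / 2 = Real.pi / 4 - θ / 2 := by ring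
    have h2 : (0 : ℝ) < Real.sqrt 2 := by positivity
    rw [e, Real.cot_eq_cos_div_sin, Real.cos_sub, Real.sin_sub, Real.cos_pi_div_four,
      Real.sin_pi_div_four, ← mul_add, ← mul_sub, mul_div_mul_left _ _ (by positivity)]
  have ht : Real.tan θ = 2 * s * c / (c ^ 2 - s ^ 2) := by
    have e : θ = 2 * (θ / 2) := by ring
    rw [Real.tan_eq_sin_div_cos]
    nth_rewrite 1 2 [e]
    rw [Real.sin_two_mul, Real.cos_two_mul']
  have hlt : 1 < c / s := (one_lt_div hs).2 hcs
  have hfac : c ^ 2 - s ^ 2 ≠ 0 := by nlinarith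
  have hsum : c + s ≠ 0 := by linarith
  simp only [lam, hl, hl', ht]
  norm_cast
  refine ⟨by linarith, by linarith, by linarith, ?_, ?_⟩
  · field_simp
  · field_simp
    ring

lemma quartic_quarterTurn (hθ : θ ∈ Set.Ioo 0 (Real.pi / 2)) (x z : ℂ) :
    quartic (Real.pi / 2 - θ) (x - Complex.I * z) (z - Complex.I * x) =
      turnFactor θ ^ 2 * quartic θ x z := by
  obtain ⟨h0, h1, h2, h3, h4⟩ := lam_relations hθ
  simp only [quartic, turnFactor, h3, h4]
  field_simp
  have hI3 : Complex.I ^ 3 = -Complex.I := Complex.I_pow_three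
  have hI4 := Complex.I_pow_four
  ring_nf
  simp only [Complex.I_sq, hI3, hI4]
  ring

/-- With `(x', z') = (x - i z, z - i x)`, `c = turnFactor θ`, and `Q`, `Q'` the two quartics, the
chain rule gives `c² ∂_z Q = ∂_z Q' - i ∂_x Q'`, and Euler's relation `x' ∂_x Q' + z' ∂_z Q' = 4 Q'`
eliminates `∂_x Q'`. -/
lemma quarticDz_quarterTurn (hθ : θ ∈ Set.Ioo 0 (Real.pi / 2)) (x z : ℂ) :
    2 * x * quarticDz (Real.pi / 2 - θ) (x - Complex.I * z) (z - Complex.I * x) =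
      turnFactor θ ^ 2 *
        ((x - Complex.I * z) * quarticDz θ x z + 4 * Complex.I * quartic θ x z) := by
  obtain ⟨h0, h1, h2, h3, h4⟩ := lam_relations hθ
  simp only [quartic, quarticDz, turnFactor, h3, h4]
  field_simp
  have hI3 : Complex.I ^ 3 = -Complex.I := Complex.I_pow_three
  ring_nf
  simp only [Complex.I_sq, hI3]
  ring


/-! ### The Weierstrass data under the isomorphism -/

lemma gauss_coeff_turn (α β : ℝ) :
    sig α (β + Real.pi / 2) - Complex.I * del α (β + Real.pi / 2) = (Real.sqrt 2 : ℂ) * sig α β ∧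
    del α (β + Real.pi / 2) - Complex.I * sig α (β + Real.pi / 2) =
      (Real.sqrt 2 : ℂ) * del α β := by
  have eA : (α + (β + Real.pi / 2)) / 2 = (α + β) / 2 + Real.pi / 4 := by ring
  have eB : (α - (β + Real.pi / 2)) / 2 = (α - β) / 2 - Real.pi / 4 := by ring
  unfold sig del
  rw [eA, eB, Real.cos_add, Real.sin_add, Real.cos_sub, Real.sin_sub, Real.cos_pi_div_four,
    Real.sin_pi_div_four]
  constructor <;> push_cast
  · linear_combination ((Complex.sin ((α + β) / 2) * (Real.sqrt 2 / 2) +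
      Complex.cos ((α + β) / 2) * (Real.sqrt 2 / 2)) : ℂ) * (-Complex.I_sq)
  · linear_combination ((Complex.cos ((α - β) / 2) * (Real.sqrt 2 / 2) +
      Complex.sin ((α - β) / 2) * (Real.sqrt 2 / 2)) : ℂ) * (-Complex.I_sq)

lemma gaussNum_quarterTurn (p : HCoord) : gaussNum α (β + Real.pi / 2) (quarterTurn θ p) =
    (Real.sqrt 2 : ℂ) * gaussNum α β p := by
  obtain ⟨h1, h2⟩ := gauss_coeff_turn α β
  simp only [gaussNum, quarterTurn]
  linear_combination p.2.1 * h1 + p.1 * h2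

lemma gaussDen_quarterTurn (p : HCoord) : gaussDen α (β + Real.pi / 2) (quarterTurn θ p) =
    (Real.sqrt 2 : ℂ) * gaussDen α β p := by
  obtain ⟨h1, h2⟩ := gauss_coeff_turn α β
  replace h1 := congrArg (starRingEnd ℂ) h1
  replace h2 := congrArg (starRingEnd ℂ) h2
  simp only [map_sub, map_mul, Complex.conj_I, Complex.conj_ofReal] at h1 h2
  simp only [gaussDen, quarterTurn]
  linear_combination Complex.I * p.1 * h1 - Complex.I * p.2.1 * h2

lemma gaussMap_quarterTurn (p : HCoord) :
    gaussMap α (β + Real.pi / 2) (quarterTurn θ p) = gaussMap α β p := by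
  have h : (Real.sqrt 2 : ℂ) ≠ 0 := by simp
  rw [gaussMap, gaussNum_quarterTurn, gaussDen_quarterTurn, mul_div_mul_left _ _ h, gaussMap]

lemma quarterTurn_mem_puncturedCone_iff (hθ : θ ∈ Set.Ioo 0 (Real.pi / 2)) (p : HCoord) :
    quarterTurn θ p ∈ puncturedCone (Real.pi / 2 - θ) α (β + Real.pi / 2) ↔
      p ∈ puncturedCone θ α β := by
  have h : (Real.sqrt 2 : ℂ) ≠ 0 := by simp
  rw [mem_puncturedCone_iff, mem_puncturedCone_iff, gaussNum_quarterTurn, gaussDen_quarterTurn,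
    mul_ne_zero_iff_left h, mul_ne_zero_iff_left h]
  simp only [quarterTurn, quartic_quarterTurn hθ, mul_pow]
  rw [mul_right_inj' (pow_ne_zero 2 (turnFactor_ne_zero hθ))]

lemma fst_ne_zero_of_branchPoint {p : HCoord} (hp : p ∈ torusCone θ) (hw : p.2.2 = 0) :
    p.1 ≠ 0 := by
  intro hx
  obtain ⟨h0, hq⟩ := hp
  rw [hw, hx] at hq
  simp [quartic] at hq
  exact h0 (by simp [hx, hq])

/-- The isomorphism multiplies `dz / w` by `2 / c`: the determinant of `(x, z) ↦ (x - i z, z - i x)` is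
`2`. At branch points the formula in terms of `dw` is used; it holds for every vector `v`, tangent
or not. -/
lemma holoDiff_quarterTurn (hθ : θ ∈ Set.Ioo 0 (Real.pi / 2)) {p : HCoord}
    (hp : p ∈ puncturedCone θ α β) (v : HCoord) :
    holoDiff (Real.pi / 2 - θ) (quarterTurn θ p) (quarterTurn θ v) =
      2 / turnFactor θ * holoDiff θ p v := by
  have hc := turnFactor_ne_zero hθ
  by_cases hw : p.2.2 = 0
  · have hw' : (quarterTurn θ p).2.2 = 0 := by simp [quarterTurn, hw]
    have hx := fst_ne_zero_of_branchPoint hp.1 hw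
    have hx' := fst_ne_zero_of_branchPoint ((quarterTurn_mem_puncturedCone_iff hθ p).2 hp).1 hw'
    have hq : quartic θ p.1 p.2.1 = 0 := by rw [← hp.1.2, hw, zero_pow two_ne_zero]
    have hdz := quarticDz_quarterTurn hθ p.1 p.2.1
    rw [hq, mul_zero, add_zero] at hdz
    have hdz' : quarticDz (Real.pi / 2 - θ) (quarterTurn θ p).1 (quarterTurn θ p).2.1 =
        turnFactor θ ^ 2 * (quarterTurn θ p).1 * quarticDz θ p.1 p.2.1 / (2 * p.1) := by
      rw [eq_div_iff (mul_ne_zero two_ne_zero hx)]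
      simp only [quarterTurn]
      linear_combination hdz
    rw [holoDiff, if_pos hw', holoDiff, if_pos hw, hdz']
    have hv : (quarterTurn θ v).2.2 = turnFactor θ * v.2.2 := rfl
    rw [hv]
    -- If `quarticDz` vanished, both sides would be `0` by division by zero.
    rcases eq_or_ne (quarticDz θ p.1 p.2.1) 0 with h0 | h0
    · simp [h0]
    · field_simp
  · have hw' : (quarterTurn θ p).2.2 ≠ 0 := mul_ne_zero hc hw
    rw [holoDiff, if_neg hw', holoDiff, if_neg hw]
    simp only [quarterTurn]
    field_simp
    linear_combination (p.2.1 * v.1 - p.1 * v.2.1) * Complex.I_sq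

/-! ### Normalization of the height differential -/

lemma ellipticK_pos {m : ℝ} (h0 : 0 ≤ m) (h1 : m < 1) : 0 < ellipticK m := by
  have hpos : ∀ u : ℝ, 0 < 1 - m * Real.sin u ^ 2 := fun u => by
    nlinarith [Real.sin_sq_le_one u, sq_nonneg (Real.sin u)]
  refine intervalIntegral.intervalIntegral_pos_of_pos (Continuous.intervalIntegrable ?_ _ _)
    (fun u => by have := hpos u; positivity) (by positivity)
  refine continuous_const.div (by fun_prop) fun u => (Real.sqrt_pos.2 (hpos u)).ne'

lemma ellipticK_sin_sq_pos (hθ : θ ∈ Set.Ioo 0 (Real.pi / 2)) : 0 < ellipticK (Real.sin θ ^ 2) := by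
  have hc : 0 < Real.cos θ := Real.cos_pos_of_mem_Ioo ⟨by linarith [hθ.1, hθ.2], hθ.2⟩
  exact ellipticK_pos (sq_nonneg _) (by nlinarith [Real.sin_sq_add_cos_sq θ])

lemma ellipticK_cos_sq_pos (hθ : θ ∈ Set.Ioo 0 (Real.pi / 2)) : 0 < ellipticK (Real.cos θ ^ 2) := by
  have hs : 0 < Real.sin θ := Real.sin_pos_of_pos_of_lt_pi hθ.1 (by linarith [hθ.1, hθ.2])
  exact ellipticK_pos (sq_nonneg _) (by nlinarith [Real.sin_sq_add_cos_sq θ])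

lemma mu_turn (hθ : θ ∈ Set.Ioo 0 (Real.pi / 2)) :
    (mu (Real.pi / 2 - θ) : ℂ) * (2 / turnFactor θ) =
      ((ellipticK (Real.sin θ ^ 2) / ellipticK (Real.cos θ ^ 2) : ℝ) : ℂ) *
        (Complex.I * (mu θ : ℂ)) := by
  have hc : Real.cos θ ≠ 0 :=
    (Real.cos_pos_of_mem_Ioo ⟨by linarith [hθ.1, hθ.2], hθ.2⟩).ne'
  have hs : Real.sin θ ≠ 0 :=
    (Real.sin_pos_of_pos_of_lt_pi hθ.1 (by linarith [hθ.1, hθ.2])).ne'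
  have hK := (ellipticK_sin_sq_pos hθ).ne'
  have hK' := (ellipticK_cos_sq_pos hθ).ne'
  have hreal : mu (Real.pi / 2 - θ) =
      ellipticK (Real.sin θ ^ 2) / ellipticK (Real.cos θ ^ 2) * mu θ * Real.tan θ := by
    rw [mu, mu, Real.sin_pi_div_two_sub, Real.tan_eq_sin_div_cos]
    field_simp
  have ht := turnFactor_ne_zero hθ
  rw [mul_div_assoc', div_eq_iff ht, hreal, turnFactor]
  generalize Real.tan θ = t
  push_cast
  linear_combination (2 * (ellipticK (Real.sin θ ^ 2) / ellipticK (Real.cos θ ^ 2)) *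
    (mu θ : ℂ) * t) * Complex.I_sq

/-- The isomorphism `Σ_θ → Σ_{π/2-θ}` pulls the Weierstrass form of `(g, dh)` back to a positive
multiple of that of `(g, i dh)`. -/
lemma weierstrassForm_quarterTurn (hθ : θ ∈ Set.Ioo 0 (Real.pi / 2)) {p : HCoord}
    (hp : p ∈ puncturedCone θ α β) (v : HCoord) :
    weierstrassForm (gaussMap α (β + Real.pi / 2)) (heightDiff (Real.pi / 2 - θ))
        (quarterTurn θ p) (quarterTurn θ v) =
      ((ellipticK (Real.sin θ ^ 2) / ellipticK (Real.cos θ ^ 2) : ℝ) : ℂ) •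
        weierstrassForm (gaussMap α β) (fun p v => Complex.I * heightDiff θ p v) p v := by
  have hdh : heightDiff (Real.pi / 2 - θ) (quarterTurn θ p) (quarterTurn θ v) =
      ((ellipticK (Real.sin θ ^ 2) / ellipticK (Real.cos θ ^ 2) : ℝ) : ℂ) *
        (Complex.I * heightDiff θ p v) := by
    rw [heightDiff, holoDiff_quarterTurn hθ hp, ← mul_assoc, mu_turn hθ, heightDiff]
    ring
  funext k
  fin_cases k <;> simp [weierstrassForm, gaussMap_quarterTurn, hdh] <;> ring

/-! ### Correspondence of surfaces and periods -/

lemma samePoint_quarterTurn {p q : HCoord} (h : SamePoint p q) :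
    SamePoint (quarterTurn θ p) (quarterTurn θ q) := by
  obtain ⟨t, ht, rfl⟩ := h
  exact ⟨t, ht, by simp only [quarterTurn]; congr 1 <;> [ring; (congr 1 <;> ring)]⟩

lemma samePoint_quarterTurnInv {p q : HCoord} (h : SamePoint p q) :
    SamePoint (quarterTurnInv θ p) (quarterTurnInv θ q) := by
  obtain ⟨t, ht, rfl⟩ := h
  exact ⟨t, ht, by simp only [quarterTurnInv]; congr 1 <;> [ring; (congr 1 <;> ring)]⟩

/-- The only excluded value that the shift can reach is `(0, π - (π/2 - θ))`, which comes from the pair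
`(0, θ)` excluded from `𝓘₁`. -/
lemma paramSetOne_turn (h : (θ, α, β) ∈ paramSetOne) :
    (Real.pi / 2 - θ, α, β + Real.pi / 2) ∈ paramSetTwo := by
  obtain ⟨⟨hθ0, hθ1⟩, ⟨hα0, hα1⟩, ⟨hβ0, hβ1⟩, hne⟩ := h
  dsimp only at *
  refine ⟨⟨by linarith, by linarith⟩, ⟨by linarith, by linarith⟩, ⟨by linarith, by linarith⟩,
    ?_, ?_, ?_, ?_⟩ <;> intro h0 <;> obtain ⟨h1, h2⟩ := Prod.mk.inj h0 <;> dsimp only at h2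
  · linarith
  · linarith
  · exact hne (Prod.ext h1 (by dsimp only; linarith))
  · linarith

lemma reVec_add (J J' : Fin 3 → ℂ) : reVec (J + J') = reVec J + reVec J' := by
  ext k; simp [reVec]

lemma reVec_ofReal_smul (r : ℝ) (J : Fin 3 → ℂ) : reVec ((r : ℂ) • J) = r • reVec J := by
  ext k; simp [reVec]

/-- Changing the base point translates a Weierstrass surface. -/
lemma weierstrassSurface_eq_image_add {U : Set HCoord} {g : HCoord → ℂ}
    {dh : HCoord → HCoord → ℂ} (hdh : ∀ p v, dh p (-v) = -dh p v) {p q : HCoord} {J : Fin 3 → ℂ}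
    (h : IsPathIntegral U (weierstrassForm g dh) p q J) :
    weierstrassSurface U g dh p = (fun y => y + reVec J) '' weierstrassSurface U g dh q := by
  ext y
  constructor
  · rintro ⟨s, J', h', rfl⟩
    refine ⟨_, ⟨s, _, (h.symm (weierstrassForm_neg hdh)).trans h', rfl⟩, ?_⟩
    simp [← reVec_add]
  · rintro ⟨_, ⟨s, J', h', rfl⟩, rfl⟩
    exact ⟨s, _, h.trans h', by simp [reVec_add, add_comm]⟩

/-- Path integrals on the two punctured tori correspond under the isomorphism
`Σ_θ → Σ_{π/2-θ}`. -/
lemma isPathIntegral_quarterTurn_iff (hθ : θ ∈ Set.Ioo 0 (Real.pi / 2)) {p q : HCoord}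
    {J : Fin 3 → ℂ} :
    IsPathIntegral (puncturedCone (Real.pi / 2 - θ) α (β + Real.pi / 2))
        (weierstrassForm (gaussMap α (β + Real.pi / 2)) (heightDiff (Real.pi / 2 - θ)))
        (quarterTurn θ p) (quarterTurn θ q)
        (((ellipticK (Real.sin θ ^ 2) / ellipticK (Real.cos θ ^ 2) : ℝ) : ℂ) • J) ↔
      IsPathIntegral (puncturedCone θ α β)
        (weierstrassForm (gaussMap α β) (fun p v => Complex.I * heightDiff θ p v)) p q J := by
  set r : ℝ := ellipticK (Real.sin θ ^ 2) / ellipticK (Real.cos θ ^ 2) with hr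
  have hr0 : (r : ℂ) ≠ 0 :=
    Complex.ofReal_ne_zero.2 (div_pos (ellipticK_sin_sq_pos hθ) (ellipticK_cos_sq_pos hθ)).ne'
  let F := quarterTurnEquiv θ hθ
  have hinv : ∀ a, F.symm (quarterTurn θ a) = a := F.symm_apply_apply
  have hF : ∀ a, quarterTurn θ (F.symm a) = a := F.apply_symm_apply
  have hmem : ∀ a ∈ puncturedCone (Real.pi / 2 - θ) α (β + Real.pi / 2),
      F.symm a ∈ puncturedCone θ α β := fun a ha => by
    rwa [← quarterTurn_mem_puncturedCone_iff hθ, hF]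
  constructor
  · intro h
    have := h.map (U' := puncturedCone θ α β)
      (Ω' := weierstrassForm (gaussMap α β) (fun p v => Complex.I * heightDiff θ p v))
      (F.symm : HCoord →L[ℝ] HCoord) (r : ℂ)⁻¹ hmem fun a ha v => by
        have := weierstrassForm_quarterTurn hθ (hmem a ha) (F.symm v)
        rw [hF, hF] at this
        rw [this, ← hr, smul_smul, inv_mul_cancel₀ hr0, one_smul]
        rfl
    rw [smul_smul, inv_mul_cancel₀ hr0, one_smul] at this
    simpa only [ContinuousLinearEquiv.coe_coe, hinv] using this
  · intro h
    exact h.map (F : HCoord →L[ℝ] HCoord) (r : ℂ)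
      (fun a ha => (quarterTurn_mem_puncturedCone_iff hθ a).2 ha)
      fun a ha v => weierstrassForm_quarterTurn hθ ha v

end

end

theorem lemma2p3 (θ α β : ℝ) (h : (θ, α, β) ∈ paramSetOne) :
    (Real.pi / 2 - θ, α, β + Real.pi / 2) ∈ paramSetTwo ∧
    ∃ r : ℝ, r = ellipticK (Real.sin θ ^ 2) / ellipticK (Real.cos θ ^ 2) ∧ 0 < r ∧
      (∀ p₀ ∈ puncturedCone θ α β,
        ∀ q₀ ∈ puncturedCone (Real.pi / 2 - θ) α (β + Real.pi / 2),
          ∃ v : EuclideanSpace ℝ (Fin 3),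
            standardExample (Real.pi / 2 - θ) α (β + Real.pi / 2) q₀ =
              (fun y => r • y + v) '' conjugateExample θ α β p₀) ∧
      standardPeriods (Real.pi / 2 - θ) α (β + Real.pi / 2) =
        (fun y => r • y) '' conjugatePeriods θ α β := by
  have hθ : θ ∈ Set.Ioo 0 (Real.pi / 2) := h.1
  have hr0 := div_pos (ellipticK_sin_sq_pos hθ) (ellipticK_cos_sq_pos hθ)
  refine ⟨paramSetOne_turn h, _, rfl, hr0, ?_, ?_⟩
  all_goals
    have hiff := @isPathIntegral_quarterTurn_iff θ α β hθ
    have hinv : ∀ a, quarterTurn θ (quarterTurnInv θ a) = a :=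
      (quarterTurnEquiv θ hθ).apply_symm_apply
    set r : ℝ := ellipticK (Real.sin θ ^ 2) / ellipticK (Real.cos θ ^ 2) with hr
    have hsmul : ∀ J : Fin 3 → ℂ, J = (r : ℂ) • ((r : ℂ)⁻¹ • J) := fun J =>
      (smul_inv_smul₀ (Complex.ofReal_ne_zero.2 hr0.ne') J).symm
  · intro p₀ hp₀ q₀ hq₀
    have hneg : ∀ p v, heightDiff (Real.pi / 2 - θ) p (-v) = -heightDiff (Real.pi / 2 - θ) p v :=
      fun p v => by rw [heightDiff, holoDiff_neg, mul_neg, heightDiff]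
    -- The translation is the integral from the given base point to the image of the other one.
    obtain ⟨J₀, hJ₀⟩ := exists_path_of_branchPoint
      (weierstrassForm_neg (g := gaussMap α (β + Real.pi / 2)) hneg)
      ((quarterTurn_mem_puncturedCone_iff hθ _).2 (branchPoint_mem_puncturedCone h))
      (by simp [quarterTurn]) hq₀ ((quarterTurn_mem_puncturedCone_iff hθ p₀).2 hp₀)
    refine ⟨reVec J₀, ?_⟩
    rw [standardExample, weierstrassSurface_eq_image_add hneg hJ₀]
    ext y
    constructor
    · rintro ⟨_, ⟨q, J, hJ, rfl⟩, rfl⟩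
      rw [← hinv q, hsmul J, hiff] at hJ
      exact ⟨_, ⟨_, _, hJ, rfl⟩, by simp only [← reVec_ofReal_smul, ← hsmul]⟩
    · rintro ⟨_, ⟨q, J, hJ, rfl⟩, rfl⟩
      exact ⟨_, ⟨_, _, hiff.2 hJ, rfl⟩, by simp only [reVec_ofReal_smul]⟩
  · ext y
    constructor
    · rintro ⟨p, q, J, hpq, hJ, rfl⟩
      rw [← hinv p, ← hinv q, hsmul J, hiff] at hJ
      exact ⟨_, ⟨_, _, _, samePoint_quarterTurnInv hpq, hJ, rfl⟩,
        by simp only [← reVec_ofReal_smul, ← hsmul]⟩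
    · rintro ⟨_, ⟨p, q, J, hpq, hJ, rfl⟩, rfl⟩
      exact ⟨_, _, _, samePoint_quarterTurn hpq, hiff.2 hJ, by simp only [reVec_ofReal_smul]⟩
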